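/- All Hilbert spaces are finite-dimensional, $\|X\|_1=\operatorname{Tr}\sqrt{X^\dagger X}$, $F(\rho,\sigma)=\bigl(\operatorname{Tr}\sqrt{\sqrt\rho\,\sigma\sqrt\rho}\bigr)^2$, $\log=\log_2$, and $|\Phi_L\rangle=L^{-1/2}\sum_{i=1}^L|i\rangle|i\rangle$. For a unit vector $v$ we also write $v$ for the state $|v\rangle\langle v|$. State merging. Let $|\Psi\rangle_{ABR}$ be a pure state shared by Alice ($A$), Bob ($B$) and a reference $R$. A map $\mathcal M: AA_0\otimes BB_0\to A_1\otimes B_1B'B$, where $A_0,B_0$ have dimension $K\ge1$, $A_1,B_1$ have dimension $L\ge1$, and $B'$ is a copy of $A$ held by Bob, is called state merging of $\Psi$ with error $\delta$ if it is LOCC and $$F\bigl((\mathcal M\otimes\mathrm{id}_R)(\Psi_{ABR}\otimes(\Phi_K)_{A_0B_0}),\ (\Phi_L)_{A_1B_1}\otimes\Psi_{B'BR}\bigr)\ \ge\ 1-\delta .$$ Its entanglement cost is $\log K-\log L$. Merging condition. Let $|\Psi\rangle_{ABR}$ be a pure state, let $A_1$ have dimension $L$, and let $P_j:A\to A_1$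 ($j$ in a finite set), $\sum_jP_j^\dagger P_j=I$, be the Kraus operators of a measurement of Alice. Let $p_j=\langle\Psi|(P_j^\dagger P_j\otimes I_{BR})|\Psi\rangle$ be the outcome probabilities, $|\Psi^j\rangle_{A_1BR}=p_j^{-1/2}(P_j\otimes I_{BR})|\Psi\rangle$ the states after the measurement, $\rho^j_{A_1R}$ their reduced states, $\rho_R$ the reduced state of $\Psi$, and $\tau_{A_1}=I/L$. Suppose that the quantum error satisfies $$Q_e:=\sum_jp_j\bigl\|\rho^j_{A_1R}-\tau_{A_1}\otimes\rho_R\bigr\|_1\le\epsilon$$ (terms with $p_j=0$ count as $0$). Then there are isometries $U_j:B\to B_1B'B$ of Bob such that 1. for every $j$ with $p_j\ne0$, $\;F\bigl((I_{A_1R}\otimes U_j)|\Psi^j\rangle,\ |\Phi_L\rangle_{A_1B_1}\otimes|\Psi\rangle_{B'BR}\bigr)=F\bigl(\rho^j_{A_1R},\ \tau_{A_1}\otimes\rho_R\bigr)$; 2. the operation $\mathcal M(X)=\sum_j(P_j\otimes U_j)X(P_j\otimes U_j)^\dagger$, in which Alice measures and tells Bob the outcome $j$, and Bob applies $U_j$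 (with $K=1$, that is, without initial entanglement), is one-way LOCC from Alice to Bob and is state merging of $\Psi$ with error $2\sqrt\epsilon$ and entanglement cost $-\log L$; 3. moreover its output state satisfies $\bigl\|(\mathcal M\otimes\mathrm{id}_R)(\Psi_{ABR})-(\Phi_L)_{A_1B_1}\otimes\Psi_{B'BR}\bigr\|_1\le2\sqrt\epsilon$. -/

import Mathlib

open scoped Matrix Kronecker

namespace StateMerging

noncomputable section

/-! A finite-dimensional quantum system is given by the finite type `A` labelling an orthonormal
basis; its Hilbert space is `A → ℂ`, operators are complex matrices, and the tensor product of the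
systems `A` and `B` is the system `A × B`. -/

/-- A unit vector. -/
def IsStateVector {n : Type*} [Fintype n] (v : n → ℂ) : Prop :=
  ∑ i, ‖v i‖ ^ 2 = 1

/-- The rank-one operator `|v⟩⟨v|`. -/
def proj {n : Type*} (v : n → ℂ) : Matrix n n ℂ :=
  Matrix.vecMulVec v (star v)

/-- The positive square root of a positive semidefinite matrix. -/
def msqrt {n : Type*} [Fintype n] [DecidableEq n] (X : Matrix n n ℂ) : Matrix n n ℂ :=
  open scoped MatrixOrder in CFC.sqrt X

/-- The trace norm `‖X‖₁ = Tr √(X† X)`. -/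
def traceNorm {n : Type*} [Fintype n] [DecidableEq n] (X : Matrix n n ℂ) : ℝ :=
  (msqrt (Xᴴ * X)).trace.re

/-- The (squared) fidelity `F(ρ, σ) = (Tr √(√ρ σ √ρ))²`. -/
def fidelity {n : Type*} [Fintype n] [DecidableEq n] (ρ σ : Matrix n n ℂ) : ℝ :=
  (msqrt (msqrt ρ * σ * msqrt ρ)).trace.re ^ 2

/-- Partial trace over the middle system. -/
def traceMid {A B R : Type*} [Fintype B] (X : Matrix (A × B × R) (A × B × R) ℂ) :
    Matrix (A × R) (A × R) ℂ :=
  fun x y => ∑ b, X (x.1, b, x.2) (y.1, b, y.2)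

/-- Partial trace over the first system. -/
def traceFst {A R : Type*} [Fintype A] (X : Matrix (A × R) (A × R) ℂ) : Matrix R R ℂ :=
  fun r s => ∑ a, X (a, r) (a, s)

/-- The maximally mixed state of dimension `L`. -/
def maxMixed (L : ℕ) : Matrix (Fin L) (Fin L) ℂ :=
  ((L : ℂ)⁻¹) • 1

/-- The maximally entangled state vector `Φ_L = L^{-1/2} ∑ᵢ |i⟩|i⟩` of Schmidt rank `L`. -/
def maxEntangled (L : ℕ) : Fin L × Fin L → ℂ :=
  fun x => if x.1 = x.2 then (((√(L : ℝ))⁻¹ : ℝ) : ℂ) else 0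

/-! ### Measurements -/

/-- Kraus operators of a measurement (one Kraus operator for each outcome, and the target space may
depend on the outcome): `∑ⱼ Kⱼ† Kⱼ = 1`. -/
def IsMeasurement {J A : Type*} [Fintype J] [Fintype A] [DecidableEq A]
    {A' : J → Type*} [∀ j, Fintype (A' j)] (K : ∀ j, Matrix (A' j) A ℂ) : Prop :=
  ∑ j, (K j)ᴴ * K j = 1

section measurement

variable {A A₁ B R : Type*} [Fintype A] [Fintype A₁] [Fintype B] [Fintype R]
  [DecidableEq B] [DecidableEq R]

/-- Probability `⟨Ψ| (P† P ⊗ 1) |Ψ⟩` of the outcome with Kraus operator `P` on the first system. -/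
def outcomeProb (Ψ : A × B × R → ℂ) (P : Matrix A₁ A ℂ) : ℝ :=
  (star Ψ ⬝ᵥ (((Pᴴ * P) ⊗ₖ (1 : Matrix (B × R) (B × R) ℂ)) *ᵥ Ψ)).re

/-- The state vector `p^{-1/2} (P ⊗ 1) |Ψ⟩` after this outcome (the zero vector if `p = 0`). -/
def postState (Ψ : A × B × R → ℂ) (P : Matrix A₁ A ℂ) : A₁ × B × R → ℂ :=
  (((√(outcomeProb Ψ P))⁻¹ : ℝ) : ℂ) • ((P ⊗ₖ (1 : Matrix (B × R) (B × R) ℂ)) *ᵥ Ψ)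

/-- The quantum error `∑ⱼ pⱼ ‖ρʲ_{A₁R} - τ_{A₁} ⊗ ρ_R‖₁` of a measurement on the first system. -/
def quantumError {J : Type*} [Fintype J] {L : ℕ} (Ψ : A × B × R → ℂ)
    (P : J → Matrix (Fin L) A ℂ) : ℝ :=
  ∑ j, outcomeProb Ψ (P j) *
    traceNorm (traceMid (proj (postState Ψ (P j))) -
      maxMixed L ⊗ₖ traceFst (traceMid (proj Ψ)))

end measurement

/-! ### LOCC operations -/

/-- The map `X ↦ K X K†`. -/
def conjMap {m n : Type*} [Fintype n] (K : Matrix m n ℂ) :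
    Matrix n n ℂ →ₗ[ℂ] Matrix m m ℂ where
  toFun X := K * X * Kᴴ
  map_add' X Y := by rw [Matrix.mul_add, Matrix.add_mul]
  map_smul' c X := by simp

/-- LOCC operations from `A ⊗ B` to `A' ⊗ B'` (Alice holds the first factor): finite protocols in
which, round by round, one of the parties performs a measurement, tells the other party the outcome,
and they continue with an LOCC operation that may depend on it. Coarse graining and discarding of
systems are covered, since the outcomes are summed over. -/
inductive IsLOCC {A' B' : Type} [Fintype A'] [DecidableEq A'] [Fintype B'] [DecidableEq B'] :
    ∀ {A B : Type} [Fintype A] [DecidableEq A] [Fintype B] [DecidableEq B],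
      (Matrix (A × B) (A × B) ℂ →ₗ[ℂ] Matrix (A' × B') (A' × B') ℂ) → Prop
  | done : IsLOCC (A := A') (B := B') LinearMap.id
  | alice {A B : Type} [Fintype A] [DecidableEq A] [Fintype B] [DecidableEq B]
      {n : ℕ} {A₁ : Fin n → Type} [∀ j, Fintype (A₁ j)] [∀ j, DecidableEq (A₁ j)]
      (K : ∀ j, Matrix (A₁ j) A ℂ) (hK : IsMeasurement K)
      (M : ∀ j, Matrix (A₁ j × B) (A₁ j × B) ℂ →ₗ[ℂ] Matrix (A' × B') (A' × B') ℂ)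
      (hM : ∀ j, IsLOCC (M j)) :
      IsLOCC (∑ j, (M j).comp (conjMap (K j ⊗ₖ (1 : Matrix B B ℂ))))
  | bob {A B : Type} [Fintype A] [DecidableEq A] [Fintype B] [DecidableEq B]
      {n : ℕ} {B₁ : Fin n → Type} [∀ j, Fintype (B₁ j)] [∀ j, DecidableEq (B₁ j)]
      (K : ∀ j, Matrix (B₁ j) B ℂ) (hK : IsMeasurement K)
      (M : ∀ j, Matrix (A × B₁ j) (A × B₁ j) ℂ →ₗ[ℂ] Matrix (A' × B') (A' × B') ℂ)
      (hM : ∀ j, IsLOCC (M j)) :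
      IsLOCC (∑ j, (M j).comp (conjMap ((1 : Matrix A A ℂ) ⊗ₖ K j)))

/-- One-way LOCC operations, with communication from Alice to Bob: Alice performs a measurement
with Kraus operators `K j` and sends the outcome `j` to Bob, who applies a quantum channel with
Kraus operators `D j k`. -/
def IsOneWayLOCC {A B A' B' : Type} [Fintype A] [DecidableEq A] [Fintype B] [DecidableEq B]
    [Fintype A'] [Fintype B']
    (M : Matrix (A × B) (A × B) ℂ →ₗ[ℂ] Matrix (A' × B') (A' × B') ℂ) : Prop :=
  ∃ (n : ℕ) (K : Fin n → Matrix A' A ℂ) (m : Fin n → ℕ)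
    (D : ∀ j, Fin (m j) → Matrix B' B ℂ),
    IsMeasurement K ∧ (∀ j, IsMeasurement (D j)) ∧
      M = ∑ j, ∑ k, conjMap (K j ⊗ₖ D j k)

/-- The action of `M ⊗ id_R` on operators. -/
def tensorId {A B A' B' R : Type*}
    (M : Matrix (A × B) (A × B) ℂ →ₗ[ℂ] Matrix (A' × B') (A' × B') ℂ)
    (X : Matrix (A × B × R) (A × B × R) ℂ) : Matrix (A' × B' × R) (A' × B' × R) ℂ :=
  fun x y => M (fun p q => X (p.1, p.2, x.2.2) (q.1, q.2, y.2.2)) (x.1, x.2.1) (y.1, y.2.1)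

/-! ### State merging -/

/-- The vector `Ψ_{ABR} ⊗ (Φ_K)_{A₀B₀}`, with Alice holding `A A₀` and Bob holding `B B₀`. -/
def mergingInput {A B R : Type*} (Ψ : A × B × R → ℂ) (K : ℕ) :
    (A × Fin K) × (B × Fin K) × R → ℂ :=
  fun x => Ψ (x.1.1, x.2.1.1, x.2.2) * maxEntangled K (x.1.2, x.2.1.2)

/-- The vector `(Φ_L)_{A₁B₁} ⊗ Ψ_{B'BR}`, with Alice holding `A₁` and Bob holding `B₁ B' B`,
where `B'` is a copy of `A`. -/
def mergingTarget {A B R : Type*} (Ψ : A × B × R → ℂ) (L : ℕ) :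
    Fin L × (Fin L × A × B) × R → ℂ :=
  fun x => maxEntangled L (x.1, x.2.1.1) * Ψ (x.2.1.2.1, x.2.1.2.2, x.2.2)

/-- The maps `A A₀ ⊗ B B₀ ⟶ A₁ ⊗ B₁ B' B` acting on operators. -/
abbrev MergingMap (A B : Type*) (K L : ℕ) :=
  Matrix ((A × Fin K) × (B × Fin K)) ((A × Fin K) × (B × Fin K)) ℂ →ₗ[ℂ]
    Matrix (Fin L × (Fin L × A × B)) (Fin L × (Fin L × A × B)) ℂ

/-- The output state `(M ⊗ id_R)(Ψ ⊗ Φ_K)`. -/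
def mergingOutput {A B R : Type*} {K L : ℕ} (Ψ : A × B × R → ℂ) (M : MergingMap A B K L) :
    Matrix (Fin L × (Fin L × A × B) × R) (Fin L × (Fin L × A × B) × R) ℂ :=
  tensorId M (proj (mergingInput Ψ K))

/-- `M` is state merging of `Ψ` with error `ε`, consuming `Φ_K` and producing `Φ_L`. -/
def IsStateMerging {A B : Type} {R : Type*} [Fintype A] [DecidableEq A] [Fintype B] [DecidableEq B]
    [Fintype R] [DecidableEq R] {K L : ℕ} (Ψ : A × B × R → ℂ) (M : MergingMap A B K L)
    (ε : ℝ) : Prop :=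
  0 < K ∧ 0 < L ∧ IsLOCC M ∧
    1 - ε ≤ fidelity (mergingOutput Ψ M) (proj (mergingTarget Ψ L))

/-- The entanglement cost (in ebits) of a merging map consuming `Φ_K` and producing `Φ_L`. -/
def entanglementCost {A B : Type*} {K L : ℕ} (_M : MergingMap A B K L) : ℝ :=
  Real.logb 2 K - Real.logb 2 L

/-- The map for which Alice performs the measurement `P`, tells Bob the outcome `j`, and Bob applies
`U j`; no initial entanglement is used (`A₀` and `B₀` are one-dimensional). -/
def measureAndDecode {A B : Type*} [Fintype A] [Fintype B] {J : Type*} [Fintype J] {L : ℕ}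
    (P : J → Matrix (Fin L) A ℂ) (U : J → Matrix (Fin L × A × B) B ℂ) : MergingMap A B 1 L :=
  ∑ j, conjMap ((P j).submatrix id Prod.fst ⊗ₖ (U j).submatrix id Prod.fst)

end

end StateMerging

/-! Tracing Bob out of Φ_L ⊗ Ψ leaves τ ⊗ ρ_R. After outcome j, the vectors Ψʲ and Φ_L ⊗ Ψ therefore
purify exactly the two states compared in the quantum error, and Uhlmann's theorem
(`exists_isometry_fidelity_eq`) gives Bob an isometry attaining their fidelity Fⱼ. The target is
pure, so fidelity with it is linear in the other state, and the output of the protocol has fidelity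
∑ pⱼ Fⱼ. The Powers–Størmer inequality gives Fⱼ ≥ 1 - ‖ρʲ - τ ⊗ ρ_R‖₁; averaging, the fidelity is at
least 1 - ε. This implies the bound 1 - 2√ε, which is void once √ε is large.

The trace norm estimate uses the same average: `traceNorm_sum_proj_sub_proj_le` gives 2√(1 - F) for
an ensemble against a pure state, proved vector by vector and summed with Cauchy–Schwarz.

The common tool is the polar decomposition `exists_polar`. It yields the variational form of the
trace norm, the formula F = ‖Y†X‖₁² for ρ = XX†, σ = YY†, and the isometry in Uhlmann's theorem. -/

namespace StateMerging

open Matrix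
open scoped ComplexOrder

/-! ### Polar decomposition, trace norm and fidelity of matrices -/

section traceNorm

variable {m n k l : Type*} [Fintype m] [DecidableEq m] [Fintype n] [DecidableEq n]
  [Fintype k] [DecidableEq k] [Fintype l] [DecidableEq l]

/-- The trace of `√(Cᴴ C)`, for a rectangular matrix `C`. -/
noncomputable def rectTraceNorm (C : Matrix m n ℂ) : ℝ := (msqrt (Cᴴ * C)).trace.re

theorem posSemidef_msqrt (X : Matrix n n ℂ) : (msqrt X).PosSemidef := by
  open scoped MatrixOrder in
  exact Matrix.nonneg_iff_posSemidef.1 (CFC.sqrt_nonneg X)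

theorem msqrt_mul_msqrt {X : Matrix n n ℂ} (hX : X.PosSemidef) : msqrt X * msqrt X = X := by
  open scoped MatrixOrder in
  exact CFC.sqrt_mul_sqrt_self X (Matrix.nonneg_iff_posSemidef.2 hX)

theorem msqrt_unique {X Y : Matrix n n ℂ} (hY : Y.PosSemidef) (h : Y * Y = X) : msqrt X = Y := by
  open scoped MatrixOrder in
  exact CFC.sqrt_unique h (Matrix.nonneg_iff_posSemidef.2 hY)

theorem conjTranspose_msqrt (X : Matrix n n ℂ) : (msqrt X)ᴴ = msqrt X :=
  (posSemidef_msqrt X).isHermitian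

/-- A matrix with orthogonal columns is an isometry times a diagonal matrix. -/
theorem exists_isometry_mul_diagonal (f : n ↪ m) (D : Matrix m n ℂ) (d : n → ℝ)
    (hD : Dᴴ * D = diagonal fun i => ((d i ^ 2 : ℝ) : ℂ)) :
    ∃ V : Matrix m n ℂ, Vᴴ * V = 1 ∧ D = V * diagonal fun i => (d i : ℂ) := by
  classical
  have hentry (i j : n) : ∑ x, D x j * star (D x i) = if i = j then ((d i ^ 2 : ℝ) : ℂ) else 0 := by
    have := congrFun (congrFun hD i) j
    simpa [Matrix.mul_apply, diagonal_apply, mul_comm] using this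
  -- The normalized columns with `d i ≠ 0` are orthonormal. They are placed at the labels `f i` and
  -- completed to a basis, whose vectors at the remaining labels `f i` serve as columns of `V` where
  -- `D` vanishes.
  let w : n → EuclideanSpace ℂ m := fun i => WithLp.toLp 2 fun x => ((d i)⁻¹ : ℂ) * D x i
  let v : m → EuclideanSpace ℂ m := Function.extend f w 0
  have hv (i : n) : v (f i) = w i := f.injective.extend_apply _ _ _
  let s : Set m := f '' {i | d i ≠ 0}
  have horth : Orthonormal ℂ (s.domRestrict v) := by
    rw [orthonormal_iff_ite]
    rintro ⟨_, i, hi, rfl⟩ ⟨_, j, hj, rfl⟩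
    simp only [Set.domRestrict_apply, hv]
    have : inner ℂ (w i) (w j) =
        ((d i)⁻¹ : ℂ) * (d j)⁻¹ * ∑ x, D x j * star (D x i) := by
      simp only [w, PiLp.inner_apply, RCLike.inner_apply, Finset.mul_sum]
      refine Finset.sum_congr rfl fun x _ => ?_
      simp
      ring
    rw [this, hentry]
    by_cases h : i = j
    · subst h
      have : (d i : ℂ) ≠ 0 := by exact_mod_cast hi
      rw [if_pos rfl, if_pos rfl]
      push_cast
      field_simp
    · rw [if_neg h, if_neg fun h' => h (f.injective (Subtype.ext_iff.1 h')), mul_zero]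
  obtain ⟨b, hb⟩ := horth.exists_orthonormalBasis_extension_of_card_eq (by simp)
  refine ⟨Matrix.of fun x i => b (f i) x, ?_, ?_⟩
  · ext i j
    have := orthonormal_iff_ite.1 b.orthonormal (f i) (f j)
    simp only [PiLp.inner_apply, RCLike.inner_apply, f.injective.eq_iff] at this
    rw [Matrix.mul_apply, Matrix.one_apply, ← this]
    exact Finset.sum_congr rfl fun x _ => by simp [mul_comm]
  · ext x i
    rw [mul_diagonal, of_apply]
    by_cases hi : d i = 0
    · have h0 := hentry i i
      have : ∑ x, ‖D x i‖ ^ 2 = 0 := by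
        have h1 : ((∑ x, ‖D x i‖ ^ 2 : ℝ) : ℂ) = 0 := by
          push_cast
          rw [if_pos rfl, hi] at h0
          simpa [Complex.mul_conj'] using h0
        exact_mod_cast h1
      have := (Finset.sum_eq_zero_iff_of_nonneg fun _ _ => by positivity).1 this x (Finset.mem_univ _)
      simpa [hi] using this
    · have : (d i : ℂ) ≠ 0 := by exact_mod_cast hi
      rw [hb (f i) ⟨i, hi, rfl⟩, hv]
      simp only [w]
      field_simp

/-- Unitary diagonalization of a Hermitian matrix. -/
theorem IsHermitian.exists_diagonal {X : Matrix n n ℂ} (hX : X.IsHermitian) :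
    ∃ (u : Matrix n n ℂ), uᴴ * u = 1 ∧ u * uᴴ = 1 ∧
      X = u * (diagonal fun i => (hX.eigenvalues i : ℂ)) * uᴴ :=
  ⟨hX.eigenvectorUnitary, Unitary.coe_star_mul_self _, Unitary.coe_mul_star_self _,
    hX.spectral_theorem⟩

/-- Polar decomposition with an isometry. -/
theorem exists_polar (f : n ↪ m) (C : Matrix m n ℂ) :
    ∃ V : Matrix m n ℂ, Vᴴ * V = 1 ∧ C = V * msqrt (Cᴴ * C) := by
  have hpos : (Cᴴ * C).PosSemidef := posSemidef_conjTranspose_mul_self C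
  obtain ⟨u, hu, hu', hd⟩ := IsHermitian.exists_diagonal hpos.isHermitian
  set e := hpos.isHermitian.eigenvalues
  have he : ∀ i, 0 ≤ e i := hpos.eigenvalues_nonneg
  have hsqrt : msqrt (Cᴴ * C) = u * (diagonal fun i => ((√(e i) : ℝ) : ℂ)) * uᴴ := by
    apply msqrt_unique
    · apply PosSemidef.mul_mul_conjTranspose_same
      rw [posSemidef_diagonal_iff]
      intro i
      exact_mod_cast Real.sqrt_nonneg _
    · rw [hd]
      have : (diagonal fun i => ((√(e i) : ℝ) : ℂ)) * (diagonal fun i => ((√(e i) : ℝ) : ℂ)) =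
          diagonal fun i => (e i : ℂ) := by
        rw [diagonal_mul_diagonal]
        congr 1
        ext i
        rw [← Complex.ofReal_mul, Real.mul_self_sqrt (he i)]
      rw [← this]
      simp only [Matrix.mul_assoc]
      rw [← Matrix.mul_assoc uᴴ u, hu, Matrix.one_mul]
  -- In the eigenbasis of `Cᴴ * C` the columns of `C * u` are orthogonal, of norms `√(e i)`.
  obtain ⟨V, hV, hCV⟩ := exists_isometry_mul_diagonal f (C * u) (fun i => √(e i)) (by
    simp only [Real.sq_sqrt (he _)]
    rw [conjTranspose_mul, Matrix.mul_assoc, ← Matrix.mul_assoc Cᴴ, hd]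
    simp only [Matrix.mul_assoc]
    rw [hu, Matrix.mul_one, ← Matrix.mul_assoc, hu, Matrix.one_mul])
  refine ⟨V * uᴴ, ?_, ?_⟩
  · rw [conjTranspose_mul, conjTranspose_conjTranspose, Matrix.mul_assoc, ← Matrix.mul_assoc Vᴴ, hV,
      Matrix.one_mul, hu']
  · rw [hsqrt, Matrix.mul_assoc V, ← Matrix.mul_assoc uᴴ, ← Matrix.mul_assoc uᴴ, hu,
      Matrix.one_mul, ← Matrix.mul_assoc, ← hCV, Matrix.mul_assoc, hu', Matrix.mul_one]

/-- With C = VH polar, the root of CC† is VHV†, and cyclicity of the trace removes V. The embedding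
only says which side of `C` is longer; exchanging `C` and `Cᴴ` covers the other case. -/
theorem rectTraceNorm_conjTranspose_of_embedding (f : n ↪ m) (C : Matrix m n ℂ) :
    rectTraceNorm Cᴴ = rectTraceNorm C := by
  obtain ⟨V, hV, hC⟩ := exists_polar f C
  set H := msqrt (Cᴴ * C) with hH
  have hHh : Hᴴ = H := conjTranspose_msqrt _
  have : msqrt (Cᴴᴴ * Cᴴ) = V * H * Vᴴ := by
    apply msqrt_unique ((posSemidef_msqrt _).mul_mul_conjTranspose_same V)
    rw [conjTranspose_conjTranspose]
    conv_rhs => rw [hC, conjTranspose_mul, hHh]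
    simp only [Matrix.mul_assoc]
    rw [← Matrix.mul_assoc Vᴴ V, hV, Matrix.one_mul]
  rw [rectTraceNorm, this, trace_mul_comm, ← Matrix.mul_assoc, hV, Matrix.one_mul, rectTraceNorm]

theorem rectTraceNorm_conjTranspose (C : Matrix m n ℂ) :
    rectTraceNorm Cᴴ = rectTraceNorm C := by
  rcases Function.Embedding.total n m with ⟨⟨f⟩⟩ | ⟨⟨f⟩⟩
  · exact rectTraceNorm_conjTranspose_of_embedding f C
  · rw [← rectTraceNorm_conjTranspose_of_embedding f Cᴴ, conjTranspose_conjTranspose]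

/-- The trace equals that of √Y X √Y, which is positive semidefinite. -/
theorem PosSemidef.re_trace_mul_nonneg {X Y : Matrix n n ℂ} (hX : X.PosSemidef)
    (hY : Y.PosSemidef) : 0 ≤ (X * Y).trace.re := by
  have h := (hX.mul_mul_conjTranspose_same (msqrt Y)).trace_nonneg
  rw [conjTranspose_msqrt, trace_mul_comm, ← Matrix.mul_assoc, msqrt_mul_msqrt hY,
    trace_mul_comm] at h
  exact (Complex.le_def.1 h).1

/-- An isometry does not increase the trace of a positive matrix. -/
theorem re_trace_mul_le {Z H : Matrix n n ℂ} (hZ : Zᴴ * Z = 1) (hH : H.PosSemidef) :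
    (Z * H).trace.re ≤ H.trace.re := by
  -- Expanding Tr (1 - Z)†(1 - Z)H ≥ 0 gives 2 Tr H - 2 Re Tr ZH ≥ 0.
  have h := PosSemidef.re_trace_mul_nonneg (posSemidef_conjTranspose_mul_self (1 - Z)) hH
  have h1 : (1 - Z)ᴴ * (1 - Z) = 1 + 1 - Z - Zᴴ := by
    rw [conjTranspose_sub, conjTranspose_one, sub_mul, mul_sub, mul_sub, hZ]
    simp only [Matrix.mul_one, Matrix.one_mul]
    abel
  have h2 : (Zᴴ * H).trace.re = (Z * H).trace.re := by
    have : Zᴴ * H = (H * Z)ᴴ := by rw [conjTranspose_mul, hH.isHermitian.eq]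
    rw [this, trace_conjTranspose, trace_mul_comm]
    simp
  rw [h1, sub_mul, sub_mul, add_mul, Matrix.one_mul, trace_sub, trace_sub, trace_add] at h
  simp only [Complex.sub_re, Complex.add_re, h2] at h
  linarith

/-- With `re_trace_mul_le_traceNorm`, this is the variational principle ‖C‖₁ = max Re Tr WC over
unitaries W: upper bounds use the maximizer, lower bounds a chosen test unitary. -/
theorem exists_traceNorm_eq (C : Matrix n n ℂ) :
    ∃ W : Matrix n n ℂ, Wᴴ * W = 1 ∧ traceNorm C = (W * C).trace.re := by
  obtain ⟨V, hV, hC⟩ := exists_polar (.refl n) C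
  refine ⟨Vᴴ, by rw [conjTranspose_conjTranspose]; exact mul_eq_one_comm.1 hV, ?_⟩
  conv_rhs => rw [hC, ← Matrix.mul_assoc, hV, Matrix.one_mul]
  rfl

theorem re_trace_mul_le_traceNorm {W : Matrix n n ℂ} (hW : Wᴴ * W = 1) (C : Matrix n n ℂ) :
    (W * C).trace.re ≤ traceNorm C := by
  obtain ⟨V, hV, hC⟩ := exists_polar (.refl n) C
  conv_lhs => rw [hC, ← Matrix.mul_assoc]
  apply re_trace_mul_le _ (posSemidef_msqrt _)
  rw [conjTranspose_mul, Matrix.mul_assoc, ← Matrix.mul_assoc Wᴴ, hW, Matrix.one_mul, hV]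

theorem traceNorm_nonneg (C : Matrix n n ℂ) : 0 ≤ traceNorm C :=
  (Complex.le_def.1 (posSemidef_msqrt _).trace_nonneg).1

/-- W is the sign of S, taken to be 1 on the kernel so that it is unitary; Sp and Sn are the
positive and negative parts, and Sp + Sn = |S|. -/
theorem IsHermitian.exists_sign {S : Matrix n n ℂ} (hS : S.IsHermitian) :
    ∃ W Sp Sn : Matrix n n ℂ, Wᴴ * W = 1 ∧ Sp.PosSemidef ∧ Sn.PosSemidef ∧ S = Sp - Sn ∧
      W * S = Sp + Sn ∧ S * W = Sp + Sn := by
  obtain ⟨u, hu, hu', hd⟩ := IsHermitian.exists_diagonal hS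
  set e := hS.eigenvalues
  let E : (n → ℝ) → Matrix n n ℂ := fun g => u * (diagonal fun i => (g i : ℂ)) * uᴴ
  have hmul (g h : n → ℝ) : E g * E h = E fun i => g i * h i := by
    simp only [E, Matrix.mul_assoc]
    rw [← Matrix.mul_assoc uᴴ u, hu, Matrix.one_mul, ← Matrix.mul_assoc (diagonal _) (diagonal _),
      diagonal_mul_diagonal]
    push_cast
    rfl
  have hadd (g h : n → ℝ) : E g + E h = E fun i => g i + h i := by
    simp only [E, ← Matrix.add_mul, ← Matrix.mul_add, diagonal_add]
    push_cast
    rfl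
  have hsub (g h : n → ℝ) : E g - E h = E fun i => g i - h i := by
    simp only [E, ← Matrix.sub_mul, ← Matrix.mul_sub, diagonal_sub]
    push_cast
    rfl
  have hpos (g : n → ℝ) (hg : ∀ i, 0 ≤ g i) : (E g).PosSemidef := by
    apply PosSemidef.mul_mul_conjTranspose_same
    rw [posSemidef_diagonal_iff]
    intro i
    exact_mod_cast hg i
  have hherm (g : n → ℝ) : (E g)ᴴ = E g := by
    simp only [E, conjTranspose_mul, conjTranspose_conjTranspose, diagonal_conjTranspose,
      Matrix.mul_assoc]
    congr 3
    ext i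
    simp
  have hone : E (fun _ => 1) = 1 := by simp [E, hu']
  refine ⟨E fun i => if 0 ≤ e i then 1 else -1, E fun i => max (e i) 0, E fun i => max (-e i) 0,
    ?_, hpos _ fun i => le_max_right _ _, hpos _ fun i => le_max_right _ _, ?_, ?_, ?_⟩
  · rw [hherm, hmul, ← hone]
    congr 1
    ext i
    split_ifs <;> simp
  · rw [hsub]
    refine hd.trans (congrArg E ?_)
    ext i
    rcases le_total 0 (e i) with h | h <;> simp [h]
  all_goals
    rw [hadd]
    conv_lhs => rw [hd]
    refine (hmul _ _).trans (congrArg E ?_)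
    ext i
    split_ifs with h
    · simp [h]
    · simp [le_of_not_ge h]

/-- The Powers–Størmer inequality. -/
theorem powers_stormer {ρ σ : Matrix n n ℂ} (hρ : ρ.PosSemidef) (hσ : σ.PosSemidef) :
    ρ.trace.re + σ.trace.re - 2 * (msqrt σ * msqrt ρ).trace.re ≤ traceNorm (ρ - σ) := by
  set a := msqrt ρ
  set b := msqrt σ
  have ha : a * a = ρ := msqrt_mul_msqrt hρ
  have hb : b * b = σ := msqrt_mul_msqrt hσ
  have hab : (a - b).IsHermitian :=
    (posSemidef_msqrt _).isHermitian.sub (posSemidef_msqrt _).isHermitian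
  obtain ⟨W, Sp, Sn, hW, hSp, hSn, hS, hWS, hSW⟩ := IsHermitian.exists_sign hab
  have h1 := PosSemidef.re_trace_mul_nonneg hSp (posSemidef_msqrt σ)
  have h2 := PosSemidef.re_trace_mul_nonneg hSn (posSemidef_msqrt ρ)
  have h3 := re_trace_mul_le_traceNorm hW (ρ - σ)
  have h4 : (W * (ρ - σ)).trace + (W * (ρ - σ)).trace =
      ((Sp + Sn) * (a + b)).trace + ((Sp + Sn) * (a + b)).trace := by
    -- The roots `a` and `b` need not commute, so a² - b² factors only after symmetrization. Under
    -- the trace against `W`, both halves give Tr |a - b|(a + b).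
    have e1 : ρ - σ + (ρ - σ) = (a - b) * (a + b) + (a + b) * (a - b) := by
      rw [← ha, ← hb]; noncomm_ring
    have e2 : (W * ((a + b) * (a - b))).trace = ((Sp + Sn) * (a + b)).trace := by
      rw [← hSW, ← Matrix.mul_assoc, trace_mul_comm, ← Matrix.mul_assoc]
    rw [← trace_add, ← Matrix.mul_add, e1, Matrix.mul_add, trace_add, e2, ← Matrix.mul_assoc, hWS]
  have h5 : (W * (ρ - σ)).trace.re = ((Sp + Sn) * (a + b)).trace.re := by
    have := congrArg Complex.re h4
    simp only [Complex.add_re] at this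
    linarith
  -- The last two summands have nonnegative trace, so Tr (a - b)² is a lower bound.
  have h6 : (Sp + Sn) * (a + b) =
      (a - b) * (a - b) + (Sp * b + Sp * b) + (Sn * a + Sn * a) := by
    conv_rhs => rw [Matrix.mul_sub, hS]
    noncomm_ring
  have h7 : ((a - b) * (a - b)).trace.re =
      ρ.trace.re + σ.trace.re - 2 * (b * a).trace.re := by
    rw [Matrix.mul_sub, Matrix.sub_mul, Matrix.sub_mul, ha, hb]
    simp only [trace_sub, Complex.sub_re, trace_mul_comm a b]
    ring
  rw [h5, h6] at h3
  simp only [trace_add, Complex.add_re, h7] at h3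
  linarith

/-- After passing to adjoints, the trace norm of Y†√ρ depends only on Y†ρY, so √ρ may be replaced by
any factor X of ρ. The factors used below are square roots, single columns and coefficient matrices
of purifications. -/
theorem fidelity_eq_rectTraceNorm {ρ σ : Matrix n n ℂ} (X : Matrix n k ℂ) (Y : Matrix n l ℂ)
    (hρ : ρ = X * Xᴴ) (hσ : σ = Y * Yᴴ) : fidelity ρ σ = rectTraceNorm (Yᴴ * X) ^ 2 := by
  have hρ' : ρ.PosSemidef := hρ ▸ posSemidef_self_mul_conjTranspose X
  have e1 : msqrt ρ * σ * msqrt ρ = (Yᴴ * msqrt ρ)ᴴ * (Yᴴ * msqrt ρ) := by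
    rw [conjTranspose_mul, conjTranspose_conjTranspose, conjTranspose_msqrt, hσ]
    simp only [Matrix.mul_assoc]
  have e2 : (Yᴴ * msqrt ρ)ᴴᴴ * (Yᴴ * msqrt ρ)ᴴ = (Yᴴ * X)ᴴᴴ * (Yᴴ * X)ᴴ := by
    simp only [conjTranspose_mul, conjTranspose_conjTranspose, conjTranspose_msqrt]
    rw [Matrix.mul_assoc, ← Matrix.mul_assoc (msqrt ρ), msqrt_mul_msqrt hρ', hρ]
    simp only [Matrix.mul_assoc]
  rw [fidelity, e1]
  change rectTraceNorm _ ^ 2 = _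
  rw [← rectTraceNorm_conjTranspose, ← rectTraceNorm_conjTranspose (Yᴴ * X)]
  simp only [rectTraceNorm]
  rw [e2]

/-- Fidelity with a pure state. -/
theorem fidelity_proj {ρ : Matrix n n ℂ} (hρ : ρ.PosSemidef) (v : n → ℂ) :
    fidelity ρ (proj v) = (star v ⬝ᵥ (ρ *ᵥ v)).re := by
  set a := star v ⬝ᵥ (ρ *ᵥ v) with ha
  have ha0 : 0 ≤ a := hρ.dotProduct_mulVec_nonneg v
  have hre : (a.re : ℂ) = a := by
    apply Complex.ext <;> simp [← (Complex.le_def.1 ha0).2]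
  have har : 0 ≤ a.re := (Complex.le_def.1 ha0).1
  let Y : Matrix n Unit ℂ := replicateCol Unit v
  rw [fidelity_eq_rectTraceNorm (msqrt ρ) Y
    (by rw [conjTranspose_msqrt, msqrt_mul_msqrt hρ])
    (by rw [conjTranspose_replicateCol, ← vecMulVec_eq]; rfl), ← rectTraceNorm_conjTranspose,
    rectTraceNorm]
  have e : (Yᴴ * msqrt ρ)ᴴᴴ * (Yᴴ * msqrt ρ)ᴴ = diagonal fun _ => (a.re : ℂ) := by
    rw [conjTranspose_conjTranspose, conjTranspose_mul, conjTranspose_conjTranspose,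
      conjTranspose_msqrt, Matrix.mul_assoc, ← Matrix.mul_assoc (msqrt ρ), msqrt_mul_msqrt hρ, hre]
    ext i j
    simp [Y, ha, Matrix.mul_apply, dotProduct, mulVec]
  have e' : msqrt (diagonal fun _ : Unit => (a.re : ℂ)) =
      diagonal fun _ => ((√a.re : ℝ) : ℂ) := by
    apply msqrt_unique
    · rw [posSemidef_diagonal_iff]
      intro i
      exact_mod_cast Real.sqrt_nonneg _
    · rw [diagonal_mul_diagonal]
      congr 1
      ext
      rw [← Complex.ofReal_mul, Real.mul_self_sqrt har]
  rw [e, e']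
  simp [Matrix.trace, Real.sq_sqrt har]

/-- A Fuchs–van de Graaf inequality. -/
theorem one_sub_traceNorm_le_fidelity {ρ σ : Matrix n n ℂ} (hρ : ρ.PosSemidef)
    (hσ : σ.PosSemidef) (hρ1 : ρ.trace = 1) (hσ1 : σ.trace = 1) :
    1 - traceNorm (ρ - σ) ≤ fidelity ρ σ := by
  have h := powers_stormer hρ hσ
  rw [hρ1, hσ1, Complex.one_re] at h
  rw [fidelity_eq_rectTraceNorm (msqrt ρ) (msqrt σ)
    (by rw [conjTranspose_msqrt, msqrt_mul_msqrt hρ])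
    (by rw [conjTranspose_msqrt, msqrt_mul_msqrt hσ]), conjTranspose_msqrt]
  have h2 : (msqrt σ * msqrt ρ).trace.re ≤ rectTraceNorm (msqrt σ * msqrt ρ) := by
    have := re_trace_mul_le_traceNorm (W := 1) (by simp) (msqrt σ * msqrt ρ)
    rwa [Matrix.one_mul] at this
  -- With x = ‖√σ√ρ‖₁, Powers–Størmer gives x ≥ 1 - ‖ρ - σ‖₁/2, and x² ≥ 2x - 1.
  nlinarith [sq_nonneg (rectTraceNorm (msqrt σ * msqrt ρ) - 1)]

end traceNorm

/-! ### Ensembles compared with a pure state -/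

section pure

variable {n : Type*} [Fintype n]

/-- Rescale t to a vector b of norm ‖a‖, with the phase z making ⟨a, b⟩ real and nonnegative. The
difference of the quadratic forms of T at a and b is half of ⟨a - b, T(a + b)⟩ + ⟨a + b, T(a - b)⟩,
hence at most ‖a - b‖‖a + b‖ in real part, and this product is the right-hand side. -/
theorem re_inner_sub_le {E : Type*} [NormedAddCommGroup E] [InnerProductSpace ℂ E]
    (T : E →ₗᵢ[ℂ] E) (a t : E) (ht : ‖t‖ = 1) :
    (inner ℂ a (T a)).re - ‖a‖ ^ 2 * (inner ℂ t (T t)).re ≤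
      2 * ‖a‖ * √(‖a‖ ^ 2 - ‖inner ℂ t a‖ ^ 2) := by
  obtain ⟨z, hz, hza⟩ : ∃ z : ℂ, ‖z‖ = 1 ∧ z * inner ℂ a t = ‖inner ℂ a t‖ := by
    by_cases h : inner ℂ a t = 0
    · exact ⟨1, by simp, by simp [h]⟩
    · have h' : (‖inner ℂ a t‖ : ℂ) ≠ 0 := by simpa using h
      refine ⟨‖inner ℂ a t‖ / inner ℂ a t, by simp [h], by field_simp⟩
  set c := ‖inner ℂ a t‖ with hc
  have hc' : ‖inner ℂ t a‖ = c := norm_inner_symm t a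
  set b : E := ((‖a‖ : ℂ) * z) • t with hb
  have hbn : ‖b‖ = ‖a‖ := by rw [hb, norm_smul, ht]; simp [hz]
  have hab : inner ℂ a b = ((‖a‖ * c : ℝ) : ℂ) := by
    rw [hb, inner_smul_right, mul_assoc, hza]; push_cast; rfl
  have hbT : inner ℂ b (T b) = ((‖a‖ ^ 2 : ℝ) : ℂ) * inner ℂ t (T t) := by
    rw [hb, map_smul, inner_smul_left, inner_smul_right]
    have : (starRingEnd ℂ) z * z = 1 := by rw [Complex.conj_mul', hz]; simp
    push_cast
    simp only [map_mul, Complex.conj_ofReal]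
    linear_combination (‖a‖ : ℂ) ^ 2 * inner ℂ t (T t) * this
  have hsum : inner ℂ (a - b) (T (a + b)) + inner ℂ (a + b) (T (a - b)) =
      2 * (inner ℂ a (T a) - inner ℂ b (T b)) := by
    simp only [map_add, map_sub, inner_add_left, inner_sub_left, inner_add_right, inner_sub_right]
    ring
  have h1 : (inner ℂ (a - b) (T (a + b))).re ≤ ‖a - b‖ * ‖a + b‖ :=
    (re_inner_le_norm (𝕜 := ℂ) (a - b) (T (a + b))).trans_eq (by rw [T.norm_map])
  have h2 : (inner ℂ (a + b) (T (a - b))).re ≤ ‖a + b‖ * ‖a - b‖ :=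
    (re_inner_le_norm (𝕜 := ℂ) (a + b) (T (a - b))).trans_eq (by rw [T.norm_map])
  have h3 := congrArg Complex.re hsum
  rw [hbT] at h3
  simp only [Complex.add_re, Complex.mul_re, Complex.sub_re, Complex.re_ofNat, Complex.im_ofNat,
    zero_mul, sub_zero, Complex.ofReal_re, Complex.ofReal_im] at h3
  have hadd : ‖a + b‖ ^ 2 = 2 * ‖a‖ ^ 2 + 2 * (‖a‖ * c) := by
    rw [norm_add_sq (𝕜 := ℂ), hab, hbn]; simp; ring
  have hsub : ‖a - b‖ ^ 2 = 2 * ‖a‖ ^ 2 - 2 * (‖a‖ * c) := by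
    rw [norm_sub_sq (𝕜 := ℂ), hab, hbn]; simp; ring
  have hca : c ≤ ‖a‖ := by simpa [ht] using norm_inner_le_norm (𝕜 := ℂ) a t
  have h4 : ‖a - b‖ * ‖a + b‖ = 2 * ‖a‖ * √(‖a‖ ^ 2 - c ^ 2) := by
    have hnn : 0 ≤ ‖a‖ ^ 2 - c ^ 2 := by nlinarith [norm_nonneg (inner ℂ a t), norm_nonneg a]
    rw [← sq_eq_sq₀ (by positivity) (by positivity), mul_pow, hadd, hsub, mul_pow, mul_pow,
      Real.sq_sqrt hnn]
    ring
  rw [hc', ← h4]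
  linarith

theorem trace_mul_proj (W : Matrix n n ℂ) (v : n → ℂ) :
    (W * proj v).trace = star v ⬝ᵥ (W *ᵥ v) := by
  rw [proj, mul_vecMulVec, trace_vecMulVec, dotProduct_comm]

theorem posSemidef_proj (v : n → ℂ) : (proj v).PosSemidef := posSemidef_vecMulVec_self_star v

theorem star_dotProduct_self (v : n → ℂ) : star v ⬝ᵥ v = ((∑ i, ‖v i‖ ^ 2 : ℝ) : ℂ) := by
  push_cast
  exact Finset.sum_congr rfl fun i _ => Complex.conj_mul' (v i)

theorem trace_proj {v : n → ℂ} (hv : IsStateVector v) : (proj v).trace = 1 := by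
  rw [proj, trace_vecMulVec, dotProduct_comm, star_dotProduct_self, hv, Complex.ofReal_one]

theorem star_dotProduct_proj_mulVec (v w : n → ℂ) :
    star v ⬝ᵥ (proj w *ᵥ v) = ((‖star v ⬝ᵥ w‖ ^ 2 : ℝ) : ℂ) := by
  have h : star w ⬝ᵥ v = star (star v ⬝ᵥ w) := by
    rw [star_dotProduct]
  rw [proj, vecMulVec_mulVec]
  simp only [op_smul_eq_smul, dotProduct_smul, h, smul_eq_mul]
  push_cast
  exact Complex.conj_mul' _

/-- Against a pure state the fidelity is an expectation value, hence additive over the ensemble. -/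
theorem fidelity_sum_proj [DecidableEq n] {J : Type*} [Fintype J] (w : J → n → ℂ) (t : n → ℂ) :
    fidelity (∑ j, proj (w j)) (proj t) = ∑ j, ‖star t ⬝ᵥ w j‖ ^ 2 := by
  rw [fidelity_proj (posSemidef_sum _ fun j _ => posSemidef_proj (w j)), sum_mulVec,
    dotProduct_sum]
  simp only [star_dotProduct_proj_mulVec]
  rw [← Complex.ofReal_sum, Complex.ofReal_re]

theorem fidelity_proj_proj [DecidableEq n] (w t : n → ℂ) :
    fidelity (proj w) (proj t) = ‖star t ⬝ᵥ w‖ ^ 2 := by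
  simpa using fidelity_sum_proj (J := Unit) (fun _ => w) t

theorem re_dotProduct_sub_le [DecidableEq n] {W : Matrix n n ℂ} (hW : Wᴴ * W = 1) (a t : n → ℂ)
    (ht : IsStateVector t) :
    (star a ⬝ᵥ (W *ᵥ a)).re - (∑ i, ‖a i‖ ^ 2) * (star t ⬝ᵥ (W *ᵥ t)).re ≤
      2 * (√(∑ i, ‖a i‖ ^ 2) * √(∑ i, ‖a i‖ ^ 2 - ‖star t ⬝ᵥ a‖ ^ 2)) := by
  let T : EuclideanSpace ℂ n →ₗᵢ[ℂ] EuclideanSpace ℂ n :=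
    { toLinearMap := toEuclideanLin W
      norm_map' := fun x => by
        have h : star (W *ᵥ x) ⬝ᵥ (W *ᵥ x) = star (x : n → ℂ) ⬝ᵥ x := by
          rw [star_mulVec, dotProduct_mulVec, vecMul_vecMul, hW, vecMul_one]
        rw [star_dotProduct_self, star_dotProduct_self] at h
        rw [EuclideanSpace.norm_eq, EuclideanSpace.norm_eq]
        exact congrArg Real.sqrt (Complex.ofReal_injective h) }
  have hin (x y : n → ℂ) : inner ℂ (WithLp.toLp 2 x) (WithLp.toLp 2 y) = star x ⬝ᵥ y := by
    rw [EuclideanSpace.inner_toLp_toLp, dotProduct_comm]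
  have hT (x : n → ℂ) : T (WithLp.toLp 2 x) = WithLp.toLp 2 (W *ᵥ x) := rfl
  have hn (x : n → ℂ) : ‖WithLp.toLp 2 x‖ = √(∑ i, ‖x i‖ ^ 2) := EuclideanSpace.norm_eq _
  have h := re_inner_sub_le T (WithLp.toLp 2 a) (WithLp.toLp 2 t) (by rw [hn, ht, Real.sqrt_one])
  rwa [hT, hT, hin, hin, hin, hn, Real.sq_sqrt (by positivity), mul_assoc] at h

theorem norm_dotProduct_sq_le (a t : n → ℂ) (ht : IsStateVector t) :
    ‖star t ⬝ᵥ a‖ ^ 2 ≤ ∑ i, ‖a i‖ ^ 2 := by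
  have h := norm_inner_le_norm (𝕜 := ℂ) (WithLp.toLp 2 t) (WithLp.toLp 2 a)
  rw [EuclideanSpace.inner_toLp_toLp, dotProduct_comm, EuclideanSpace.norm_eq,
    EuclideanSpace.norm_eq] at h
  change _ ≤ √(∑ i, ‖t i‖ ^ 2) * √(∑ i, ‖a i‖ ^ 2) at h
  rw [ht, Real.sqrt_one, one_mul] at h
  exact (Real.le_sqrt (norm_nonneg _) (by positivity)).1 h

/-- A Fuchs–van de Graaf inequality for an ensemble and a pure state. -/
theorem traceNorm_sum_proj_sub_proj_le [DecidableEq n] {J : Type*} [Fintype J] (w : J → n → ℂ) (t : n → ℂ)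
    (ht : IsStateVector t) (hw : ∑ j, ∑ i, ‖w j i‖ ^ 2 = 1) :
    traceNorm (∑ j, proj (w j) - proj t) ≤ 2 * √(1 - ∑ j, ‖star t ⬝ᵥ w j‖ ^ 2) := by
  obtain ⟨W, hW, hWt⟩ := exists_traceNorm_eq (∑ j, proj (w j) - proj t)
  -- The weights ‖w j‖² sum to 1, so `proj t` can be distributed over the ensemble with these
  -- weights.
  have h1 : (W * (∑ j, proj (w j) - proj t)).trace.re =
      ∑ j, ((star (w j) ⬝ᵥ (W *ᵥ w j)).re -
        (∑ i, ‖w j i‖ ^ 2) * (star t ⬝ᵥ (W *ᵥ t)).re) := by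
    rw [Finset.sum_sub_distrib, ← Finset.sum_mul, hw, one_mul, Matrix.mul_sub, Matrix.mul_sum,
      trace_sub, trace_sum, trace_mul_proj]
    simp only [trace_mul_proj, Complex.sub_re, Complex.re_sum]
  rw [hWt, h1]
  refine (Finset.sum_le_sum fun j _ => re_dotProduct_sub_le hW (w j) t ht).trans ?_
  rw [← Finset.mul_sum]
  have := Real.sum_sqrt_mul_sqrt_le Finset.univ
    (f := fun j => ∑ i, ‖w j i‖ ^ 2) (g := fun j => ∑ i, ‖w j i‖ ^ 2 - ‖star t ⬝ᵥ w j‖ ^ 2)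
    (fun j => by positivity) (fun j => sub_nonneg.2 (norm_dotProduct_sq_le _ _ ht))
  rw [Finset.sum_sub_distrib, hw, Real.sqrt_one, one_mul] at this
  linarith

end pure

/-! ### Uhlmann's theorem -/

section uhlmann

variable {a b c r : Type*} [Fintype b]

/-- The matrix of coefficients of a tripartite vector, with the middle system as columns. -/
def midMatrix {a b r : Type*} (v : a × b × r → ℂ) : Matrix (a × r) b ℂ :=
  Matrix.of fun x y => v (x.1, y, x.2)

theorem traceMid_proj (v : a × b × r → ℂ) :
    traceMid (proj v) = midMatrix v * (midMatrix v)ᴴ := by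
  ext x y
  simp [traceMid, proj, midMatrix, Matrix.mul_apply, vecMulVec_apply]

theorem kronecker_mulVec_apply {a' : Type*} [Fintype a] [Fintype r] [DecidableEq r]
    (P : Matrix a' a ℂ) (U : Matrix c b ℂ)
    (v : a × b × r → ℂ) (x : a') (y : c) (z : r) :
    ((P ⊗ₖ (U ⊗ₖ (1 : Matrix r r ℂ))) *ᵥ v) (x, y, z) =
      ∑ i, ∑ j, P x i * U y j * v (i, j, z) := by
  simp [mulVec, dotProduct, Fintype.sum_prod_type, kroneckerMap_apply, Matrix.one_apply, mul_assoc]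

/-- Uhlmann's theorem, with an isometry on the purifying system. -/
theorem exists_isometry_fidelity_eq [DecidableEq b] [Fintype a] [DecidableEq a] [Fintype c]
    [DecidableEq c] [Fintype r] [DecidableEq r] (f : b ↪ c) (v : a × b × r → ℂ) (t : a × c × r → ℂ) :
    ∃ U : Matrix c b ℂ, Uᴴ * U = 1 ∧
      fidelity (proj (((1 : Matrix a a ℂ) ⊗ₖ (U ⊗ₖ (1 : Matrix r r ℂ))) *ᵥ v)) (proj t) =
        fidelity (traceMid (proj v)) (traceMid (proj t)) := by
  obtain ⟨V, hV, hC⟩ := exists_polar f ((midMatrix t)ᴴ * midMatrix v)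
  set C := (midMatrix t)ᴴ * midMatrix v with hCdef
  -- The overlap with the target is Tr UᵀC. Taking U to be the entrywise conjugate of V turns it
  -- into Tr V†C = Tr √(C†C).
  refine ⟨V.map star, ?_, ?_⟩
  · have : (V.map star)ᴴ * V.map star = (Vᴴ * V)ᵀ := by
      ext i j
      simp [Matrix.mul_apply, mul_comm]
    rw [this, hV, transpose_one]
  · rw [fidelity_proj_proj, fidelity_eq_rectTraceNorm _ _ (traceMid_proj v) (traceMid_proj t)]
    have h1 : star t ⬝ᵥ (((1 : Matrix a a ℂ) ⊗ₖ (V.map star ⊗ₖ (1 : Matrix r r ℂ))) *ᵥ v) =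
        (Vᴴ * C).trace := by
      simp only [dotProduct, Fintype.sum_prod_type, kronecker_mulVec_apply, trace, diag_apply,
        Matrix.mul_apply, hCdef, midMatrix, conjTranspose_apply, of_apply, map_apply,
        Finset.mul_sum, Matrix.one_apply, ite_mul, one_mul, zero_mul, Pi.star_apply,
        Finset.sum_ite_irrel, Finset.sum_const_zero, Finset.sum_ite_eq, Finset.mem_univ, if_true]
      rw [Finset.sum_comm]
      conv_rhs => rw [Finset.sum_comm]
      refine Finset.sum_congr rfl fun y _ => ?_
      conv_rhs => rw [Finset.sum_comm]
      refine Finset.sum_congr rfl fun x _ => ?_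
      conv_rhs => rw [Finset.sum_comm]
      refine Finset.sum_congr rfl fun z _ => Finset.sum_congr rfl fun i _ => ?_
      ring
    have h2 : Vᴴ * C = msqrt (Cᴴ * C) := by
      conv_lhs => rw [hC, ← Matrix.mul_assoc, hV, Matrix.one_mul]
    rw [h1, h2]
    have h3 := Complex.le_def.1 (posSemidef_msqrt (Cᴴ * C)).trace_nonneg
    have h4 : (msqrt (Cᴴ * C)).trace = (rectTraceNorm C : ℂ) :=
      Complex.ext rfl (by simpa using h3.2.symm)
    rw [h4, Complex.norm_real, Real.norm_eq_abs, sq_abs]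

end uhlmann

/-! ### The protocol as an LOCC map, and its output -/

section merging

theorem conjMap_comp {m n k : Type*} [Fintype n] [Fintype k] (K : Matrix m n ℂ)
    (K' : Matrix n k ℂ) : (conjMap K).comp (conjMap K') = conjMap (K * K') := by
  ext1 X
  simp [conjMap, Matrix.mul_assoc, conjTranspose_mul]

theorem IsMeasurement.submatrix_fst {J A A' : Type*} [Fintype J] [Fintype A] [DecidableEq A]
    [Fintype A'] {P : J → Matrix A' A ℂ} (hP : IsMeasurement P) :
    IsMeasurement fun j => (P j).submatrix id (Prod.fst : A × Fin 1 → A) := by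
  have h : ∑ j, (P j)ᴴ * P j = 1 := hP
  have h' : ∑ j, ((P j).submatrix id (Prod.fst : A × Fin 1 → A))ᴴ *
      (P j).submatrix id (Prod.fst : A × Fin 1 → A) =
      (∑ j, (P j)ᴴ * P j).submatrix Prod.fst Prod.fst := by
    ext x y
    simp [Matrix.sum_apply, Matrix.mul_apply]
  rw [IsMeasurement, h', h]
  exact submatrix_one _ fun x y hxy => Prod.ext hxy (Subsingleton.elim _ _)

theorem IsMeasurement.comp_equiv {J J' A A' : Type*} [Fintype J] [Fintype J'] [Fintype A]
    [DecidableEq A] [Fintype A'] {P : J → Matrix A' A ℂ} (hP : IsMeasurement P) (e : J' ≃ J) :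
    IsMeasurement fun j => P (e j) :=
  (e.sum_comp fun j => (P j)ᴴ * P j).trans hP

theorem isMeasurement_const {A A' : Type*} [Fintype A] [DecidableEq A] [Fintype A']
    {U : Matrix A' A ℂ} (hU : Uᴴ * U = 1) : IsMeasurement fun _ : Fin 1 => U := by
  simpa [IsMeasurement] using hU

theorem isOneWayLOCC_measureAndDecode {A B : Type} {J : Type*} [Fintype A] [DecidableEq A]
    [Fintype B] [DecidableEq B] [Fintype J] {L : ℕ} {P : J → Matrix (Fin L) A ℂ}
    {U : J → Matrix (Fin L × A × B) B ℂ} (hP : IsMeasurement P) (hU : ∀ j, (U j)ᴴ * U j = 1) :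
    IsOneWayLOCC (measureAndDecode P U) := by
  let e := (Fintype.equivFin J).symm
  refine ⟨_, _, fun _ => 1, fun j _ => (U (e j)).submatrix id Prod.fst,
    hP.submatrix_fst.comp_equiv e, fun j => (isMeasurement_const (hU (e j))).submatrix_fst, ?_⟩
  simp only [Finset.univ_unique, Finset.sum_singleton]
  exact (e.sum_comp fun j => conjMap
    ((P j).submatrix id Prod.fst ⊗ₖ (U j).submatrix id Prod.fst)).symm

theorem isLOCC_measureAndDecode {A B : Type} {J : Type*} [Fintype A] [DecidableEq A]
    [Fintype B] [DecidableEq B] [Fintype J] {L : ℕ} {P : J → Matrix (Fin L) A ℂ}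
    {U : J → Matrix (Fin L × A × B) B ℂ} (hP : IsMeasurement P) (hU : ∀ j, (U j)ᴴ * U j = 1) :
    IsLOCC (measureAndDecode P U) := by
  let e := (Fintype.equivFin J).symm
  -- An isometry is a measurement with a single outcome, so Bob's decoding is one further round.
  have h := IsLOCC.alice _ (hP.submatrix_fst.comp_equiv e) _ fun j =>
    IsLOCC.bob (A := Fin L) _ (isMeasurement_const (hU (e j))).submatrix_fst _
      fun _ => IsLOCC.done
  convert h using 1
  simp only [Finset.univ_unique, Finset.sum_singleton, LinearMap.id_comp, conjMap_comp,
    ← mul_kronecker_mul, Matrix.one_mul, Matrix.mul_one]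
  exact (e.sum_comp fun j => conjMap
    ((P j).submatrix id Prod.fst ⊗ₖ (U j).submatrix id Prod.fst)).symm

theorem tensorId_sum {A B A' B' R J : Type*} [Fintype J]
    (M : J → Matrix (A × B) (A × B) ℂ →ₗ[ℂ] Matrix (A' × B') (A' × B') ℂ)
    (X : Matrix (A × B × R) (A × B × R) ℂ) : tensorId (∑ j, M j) X = ∑ j, tensorId (M j) X := by
  ext x y
  let Y : Matrix (A × B) (A × B) ℂ :=
    Matrix.of fun p q => X (p.1, p.2, x.2.2) (q.1, q.2, y.2.2)
  change (∑ j, M j) Y (x.1, x.2.1) (y.1, y.2.1) = _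
  rw [LinearMap.sum_apply, Matrix.sum_apply, Matrix.sum_apply]
  rfl

theorem tensorId_conjMap_proj {A B A' B' R : Type*} [Fintype A] [Fintype B] [Fintype R]
    [DecidableEq R] (K : Matrix A' A ℂ) (D : Matrix B' B ℂ) (v : A × B × R → ℂ) :
    tensorId (conjMap (K ⊗ₖ D)) (proj v) =
      proj ((K ⊗ₖ (D ⊗ₖ (1 : Matrix R R ℂ))) *ᵥ v) := by
  -- For fixed reference indices, the block of `proj v` is the rank-one operator built from two
  -- slices of `v`.
  let s (z : R) : A × B → ℂ := fun p => v (p.1, p.2, z)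
  have hs (x : A' × B' × R) :
      ((K ⊗ₖ (D ⊗ₖ (1 : Matrix R R ℂ))) *ᵥ v) x = ((K ⊗ₖ D) *ᵥ s x.2.2) (x.1, x.2.1) := by
    obtain ⟨x, y, z⟩ := x
    rw [kronecker_mulVec_apply]
    simp [mulVec, dotProduct, Fintype.sum_prod_type, s]
  ext x y
  change ((K ⊗ₖ D) * vecMulVec (s x.2.2) (star (s y.2.2)) * (K ⊗ₖ D)ᴴ) (x.1, x.2.1) (y.1, y.2.1) = _
  rw [mul_vecMulVec, vecMulVec_mul, ← star_mulVec, proj, vecMulVec_apply, vecMulVec_apply,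
    Pi.star_apply, Pi.star_apply, hs, hs]

theorem submatrix_mulVec_mergingInput {A B R A' B' : Type*} [Fintype A] [Fintype B] [Fintype R]
    [DecidableEq R] (P : Matrix A' A ℂ) (U : Matrix B' B ℂ) (Ψ : A × B × R → ℂ) :
    (P.submatrix id Prod.fst ⊗ₖ (U.submatrix id Prod.fst ⊗ₖ (1 : Matrix R R ℂ))) *ᵥ
      mergingInput Ψ 1 = (P ⊗ₖ (U ⊗ₖ (1 : Matrix R R ℂ))) *ᵥ Ψ := by
  ext ⟨x, y, z⟩
  rw [kronecker_mulVec_apply, kronecker_mulVec_apply]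
  simp [Fintype.sum_prod_type, mergingInput, maxEntangled]

theorem mergingOutput_measureAndDecode {A B R J : Type*} [Fintype A] [Fintype B] [Fintype R]
    [DecidableEq R] [Fintype J] {L : ℕ} (Ψ : A × B × R → ℂ) (P : J → Matrix (Fin L) A ℂ)
    (U : J → Matrix (Fin L × A × B) B ℂ) :
    mergingOutput Ψ (measureAndDecode P U) =
      ∑ j, proj ((P j ⊗ₖ (U j ⊗ₖ (1 : Matrix R R ℂ))) *ᵥ Ψ) := by
  rw [mergingOutput, measureAndDecode, tensorId_sum]
  simp only [tensorId_conjMap_proj, submatrix_mulVec_mergingInput]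

theorem isStateVector_maxEntangled {L : ℕ} (hL : 0 < L) : IsStateVector (maxEntangled L) := by
  have : (L : ℝ) ≠ 0 := by positivity
  have h (x y : Fin L) : ‖maxEntangled L (x, y)‖ ^ 2 = if x = y then (L : ℝ)⁻¹ else 0 := by
    rw [maxEntangled]
    split_ifs <;> simp [Real.sq_sqrt]
  simp [IsStateVector, Fintype.sum_prod_type, h, this]

theorem isStateVector_mergingTarget {A B R : Type*} [Fintype A] [Fintype B] [Fintype R]
    {Ψ : A × B × R → ℂ} (hΨ : IsStateVector Ψ) {L : ℕ} (hL : 0 < L) :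
    IsStateVector (mergingTarget Ψ L) := by
  have h := isStateVector_maxEntangled hL
  simp only [IsStateVector, Fintype.sum_prod_type] at h hΨ
  simp only [IsStateVector, mergingTarget, Fintype.sum_prod_type, norm_mul, mul_pow,
    ← Finset.mul_sum, hΨ, mul_one, h]

/-- This makes the target a purification of the ideal state in the quantum error, as Uhlmann's
theorem requires. -/
theorem traceMid_proj_mergingTarget {A B R : Type*} [Fintype A] [Fintype B] [Fintype R]
    (Ψ : A × B × R → ℂ) (L : ℕ) :
    traceMid (proj (mergingTarget Ψ L)) = maxMixed L ⊗ₖ traceFst (traceMid (proj Ψ)) := by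
  have h : ((√(L : ℝ))⁻¹ : ℂ) * (√(L : ℝ) : ℂ)⁻¹ = (L : ℂ)⁻¹ := by
    rw [← mul_inv, ← Complex.ofReal_mul, Real.mul_self_sqrt (Nat.cast_nonneg L),
      Complex.ofReal_natCast]
  have h' (x y : Fin L) : ∑ z, maxEntangled L (x, z) * star (maxEntangled L (y, z)) =
      maxMixed L x y := by
    by_cases hxy : x = y
    · subst hxy
      simp [maxEntangled, maxMixed, h]
    · simp [maxEntangled, maxMixed, hxy, Ne.symm hxy]
  ext ⟨x, r⟩ ⟨y, s⟩
  rw [kroneckerMap_apply, ← h']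
  simp only [traceMid, traceFst, proj, vecMulVec_apply, mergingTarget, Fintype.sum_prod_type,
    Pi.star_apply, star_mul', Finset.sum_mul, Finset.mul_sum]
  rw [Finset.sum_comm]
  refine Finset.sum_congr rfl fun a _ => ?_
  rw [Finset.sum_comm]
  refine Finset.sum_congr rfl fun b _ => Finset.sum_congr rfl fun z _ => ?_
  ring

theorem trace_traceMid {A B R : Type*} [Fintype A] [Fintype B] [Fintype R]
    (X : Matrix (A × B × R) (A × B × R) ℂ) : (traceMid X).trace = X.trace := by
  simp only [trace, traceMid, diag_apply, Fintype.sum_prod_type]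
  exact Finset.sum_congr rfl fun a _ => Finset.sum_comm

theorem posSemidef_traceMid_proj {A B R : Type*} [Fintype A] [Fintype B] [Fintype R]
    (v : A × B × R → ℂ) : (traceMid (proj v)).PosSemidef := by
  rw [traceMid_proj]
  exact posSemidef_self_mul_conjTranspose _

/-! ### Outcome probabilities and post-measurement vectors -/

section outcome

variable {A A₁ B R : Type*} [Fintype A] [Fintype A₁] [Fintype B] [Fintype R]
  [DecidableEq B] [DecidableEq R]

theorem outcomeProb_eq (Ψ : A × B × R → ℂ) (P : Matrix A₁ A ℂ) :
    outcomeProb Ψ P = ∑ x, ‖((P ⊗ₖ (1 : Matrix (B × R) (B × R) ℂ)) *ᵥ Ψ) x‖ ^ 2 := by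
  have h : (Pᴴ * P) ⊗ₖ (1 : Matrix (B × R) (B × R) ℂ) =
      (P ⊗ₖ (1 : Matrix (B × R) (B × R) ℂ))ᴴ * (P ⊗ₖ (1 : Matrix (B × R) (B × R) ℂ)) := by
    rw [conjTranspose_kronecker, ← mul_kronecker_mul, conjTranspose_one, Matrix.one_mul]
  rw [outcomeProb, h, ← mulVec_mulVec, dotProduct_mulVec, ← star_mulVec, star_dotProduct_self,
    Complex.ofReal_re]

theorem outcomeProb_nonneg (Ψ : A × B × R → ℂ) (P : Matrix A₁ A ℂ) : 0 ≤ outcomeProb Ψ P := by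
  rw [outcomeProb_eq]
  positivity

theorem sum_outcomeProb [DecidableEq A] {J : Type*} [Fintype J] {Ψ : A × B × R → ℂ}
    (hΨ : IsStateVector Ψ) {P : J → Matrix A₁ A ℂ} (hP : IsMeasurement P) :
    ∑ j, outcomeProb Ψ (P j) = 1 := by
  have hP' : ∑ j, (P j)ᴴ * P j = 1 := hP
  have h : ∑ j, ((P j)ᴴ * P j) ⊗ₖ (1 : Matrix (B × R) (B × R) ℂ) = 1 := by
    rw [← one_kronecker_one (m := A), ← hP']
    ext x y
    simp [Matrix.sum_apply, Finset.sum_mul]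
  simp only [outcomeProb]
  rw [← Complex.re_sum, ← dotProduct_sum, ← sum_mulVec, h, one_mulVec, star_dotProduct_self, hΨ,
    Complex.ofReal_one, Complex.one_re]

theorem sqrt_smul_postState (Ψ : A × B × R → ℂ) (P : Matrix A₁ A ℂ) :
    ((√(outcomeProb Ψ P) : ℝ) : ℂ) • postState Ψ P =
      (P ⊗ₖ (1 : Matrix (B × R) (B × R) ℂ)) *ᵥ Ψ := by
  -- The probability is the squared norm of the unnormalized vector, which therefore vanishes
  -- together with it.
  by_cases h : outcomeProb Ψ P = 0
  · rw [h, Real.sqrt_zero, Complex.ofReal_zero, zero_smul]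
    rw [outcomeProb_eq, Finset.sum_eq_zero_iff_of_nonneg fun _ _ => by positivity] at h
    ext x
    exact (by simpa using h x (Finset.mem_univ x) : _ = (0 : ℂ)).symm
  · have : √(outcomeProb Ψ P) ≠ 0 := by
      rwa [Ne, Real.sqrt_eq_zero (outcomeProb_nonneg Ψ P)]
    rw [postState, smul_smul, ← Complex.ofReal_mul, mul_inv_cancel₀ this, Complex.ofReal_one,
      one_smul]

theorem isStateVector_postState {Ψ : A × B × R → ℂ} {P : Matrix A₁ A ℂ}
    (h : outcomeProb Ψ P ≠ 0) : IsStateVector (postState Ψ P) := by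
  simp only [IsStateVector, postState, Pi.smul_apply, smul_eq_mul, norm_mul, mul_pow,
    ← Finset.mul_sum, ← outcomeProb_eq, Complex.norm_real, norm_inv, inv_pow, Real.norm_eq_abs,
    sq_abs]
  rw [Real.sq_sqrt (outcomeProb_nonneg Ψ P), inv_mul_cancel₀ h]

theorem kronecker_mulVec_eq_smul_postState [DecidableEq A₁] {C : Type*} [Fintype C]
    (Ψ : A × B × R → ℂ) (P : Matrix A₁ A ℂ) (U : Matrix C B ℂ) :
    (P ⊗ₖ (U ⊗ₖ (1 : Matrix R R ℂ))) *ᵥ Ψ = ((√(outcomeProb Ψ P) : ℝ) : ℂ) •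
      (((1 : Matrix A₁ A₁ ℂ) ⊗ₖ (U ⊗ₖ (1 : Matrix R R ℂ))) *ᵥ postState Ψ P) := by
  rw [← mulVec_smul, sqrt_smul_postState, mulVec_mulVec, ← mul_kronecker_mul, Matrix.one_mul,
    Matrix.mul_one]

theorem sum_norm_sq_kronecker_mulVec [DecidableEq A₁] {C : Type*} [Fintype C]
    (Ψ : A × B × R → ℂ) (P : Matrix A₁ A ℂ) {U : Matrix C B ℂ} (hU : Uᴴ * U = 1) :
    ∑ x, ‖((P ⊗ₖ (U ⊗ₖ (1 : Matrix R R ℂ))) *ᵥ Ψ) x‖ ^ 2 = outcomeProb Ψ P := by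
  have h : (P ⊗ₖ (U ⊗ₖ (1 : Matrix R R ℂ)))ᴴ * (P ⊗ₖ (U ⊗ₖ (1 : Matrix R R ℂ))) =
      (Pᴴ * P) ⊗ₖ (1 : Matrix (B × R) (B × R) ℂ) := by
    rw [conjTranspose_kronecker, conjTranspose_kronecker, ← mul_kronecker_mul,
      ← mul_kronecker_mul, hU, conjTranspose_one, Matrix.one_mul, one_kronecker_one]
  rw [outcomeProb, ← h, ← mulVec_mulVec, dotProduct_mulVec, ← star_mulVec, star_dotProduct_self,
    Complex.ofReal_re]

end outcome

/-! ### From the quantum error to the merging fidelity -/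

theorem nonempty_of_isStateVector {n : Type*} [Fintype n] {v : n → ℂ} (hv : IsStateVector v) :
    Nonempty n := by
  by_contra h
  rw [not_nonempty_iff] at h
  simp [IsStateVector] at hv

theorem IsMeasurement.pos_dim {A J : Type*} [Fintype A] [DecidableEq A] [Nonempty A] [Fintype J]
    {L : ℕ} {P : J → Matrix (Fin L) A ℂ} (hP : IsMeasurement P) : 0 < L := by
  by_contra h
  obtain rfl : L = 0 := by omega
  have hP' : ∑ j, (P j)ᴴ * P j = 1 := hP
  obtain ⟨a⟩ := ‹Nonempty A›
  have := congrFun (congrFun hP' a) a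
  simp [Matrix.sum_apply] at this

/-- A small quantum error gives a high average fidelity with the merged state. -/
theorem one_sub_quantumError_le {A B R J : Type*} [Fintype A] [DecidableEq A]
    [Fintype B] [DecidableEq B] [Fintype R] [DecidableEq R] [Fintype J] {L : ℕ} (hL : 0 < L)
    {Ψ : A × B × R → ℂ} (hΨ : IsStateVector Ψ)
    {P : J → Matrix (Fin L) A ℂ} (hP : IsMeasurement P)
    {U : J → Matrix (Fin L × A × B) B ℂ}
    (hU : ∀ j, outcomeProb Ψ (P j) ≠ 0 →
      fidelity (proj (((1 : Matrix (Fin L) (Fin L) ℂ) ⊗ₖ (U j ⊗ₖ (1 : Matrix R R ℂ))) *ᵥ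
        postState Ψ (P j))) (proj (mergingTarget Ψ L)) =
        fidelity (traceMid (proj (postState Ψ (P j))))
          (maxMixed L ⊗ₖ traceFst (traceMid (proj Ψ)))) :
    1 - quantumError Ψ P ≤ ∑ j, ‖star (mergingTarget Ψ L) ⬝ᵥ
      ((P j ⊗ₖ (U j ⊗ₖ (1 : Matrix R R ℂ))) *ᵥ Ψ)‖ ^ 2 := by
  rw [quantumError, ← sum_outcomeProb hΨ hP, ← Finset.sum_sub_distrib]
  refine Finset.sum_le_sum fun j _ => ?_
  set p := outcomeProb Ψ (P j) with hp
  have hp0 : 0 ≤ p := outcomeProb_nonneg _ _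
  rw [kronecker_mulVec_eq_smul_postState, dotProduct_smul, norm_smul, mul_pow,
    ← fidelity_proj_proj, Complex.norm_real, Real.norm_eq_abs, sq_abs, Real.sq_sqrt hp0]
  by_cases h : p = 0
  · simp [h]
  · rw [hU j h]
    have hσ := traceMid_proj_mergingTarget Ψ L
    have := one_sub_traceNorm_le_fidelity (posSemidef_traceMid_proj (postState Ψ (P j)))
      (hσ ▸ posSemidef_traceMid_proj (mergingTarget Ψ L))
      (by rw [trace_traceMid, trace_proj (isStateVector_postState h)])
      (by rw [← hσ, trace_traceMid, trace_proj (isStateVector_mergingTarget hΨ hL)])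
    calc _ = p * (1 - _) := by rw [mul_one_sub]
      _ ≤ _ := mul_le_mul_of_nonneg_left this hp0

end merging

end StateMerging

theorem proposition1 {A B : Type} {R : Type*} [Fintype A] [DecidableEq A]
    [Fintype B] [DecidableEq B] [Fintype R] [DecidableEq R]
    {J : Type*} [Fintype J] {L : ℕ}
    (Ψ : A × B × R → ℂ) (hΨ : StateMerging.IsStateVector Ψ)
    (P : J → Matrix (Fin L) A ℂ) (hP : StateMerging.IsMeasurement P)
    (ε : ℝ) (hQ : StateMerging.quantumError Ψ P ≤ ε) :
    ∃ U : J → Matrix (Fin L × A × B) B ℂ,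
      -- the `U j` are isometries
      (∀ j, (U j)ᴴ * U j = 1) ∧
      -- they attain the fidelity of the reduced states
      (∀ j, StateMerging.outcomeProb Ψ (P j) ≠ 0 →
        StateMerging.fidelity
            (StateMerging.proj
              (((1 : Matrix (Fin L) (Fin L) ℂ) ⊗ₖ (U j ⊗ₖ (1 : Matrix R R ℂ))) *ᵥ
                StateMerging.postState Ψ (P j)))
            (StateMerging.proj (StateMerging.mergingTarget Ψ L)) =
          StateMerging.fidelity
            (StateMerging.traceMid (StateMerging.proj (StateMerging.postState Ψ (P j))))
            (StateMerging.maxMixed L ⊗ₖ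
              StateMerging.traceFst (StateMerging.traceMid (StateMerging.proj Ψ)))) ∧
      -- the resulting one-way LOCC operation merges `Ψ` at the claimed cost, with the claimed error
      StateMerging.IsOneWayLOCC (StateMerging.measureAndDecode P U) ∧
      StateMerging.IsStateMerging Ψ (StateMerging.measureAndDecode P U) (2 * √ε) ∧
      StateMerging.entanglementCost (StateMerging.measureAndDecode P U) = -Real.logb 2 L ∧
      StateMerging.traceNorm
          (StateMerging.mergingOutput Ψ (StateMerging.measureAndDecode P U) -
            StateMerging.proj (StateMerging.mergingTarget Ψ L)) ≤ 2 * √ε := by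
  open StateMerging in
  obtain ⟨a, -⟩ := (nonempty_of_isStateVector hΨ).some
  have : Nonempty A := ⟨a⟩
  have hL : 0 < L := hP.pos_dim
  -- Bob's isometry needs room for `B` in B₁B'B; fixed labels in the other two factors provide it.
  let f : B ↪ Fin L × A × B := ⟨fun b => (⟨0, hL⟩, a, b), fun b b' h => by simpa using h⟩
  -- Uhlmann's theorem needs no normalization, so outcomes of probability zero, whose vector is 0,
  -- also receive an isometry.
  choose U hU hF using fun j => exists_isometry_fidelity_eq (r := R) f (postState Ψ (P j))
    (mergingTarget Ψ L)
  simp only [traceMid_proj_mergingTarget] at hF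
  have hq := one_sub_quantumError_le hL hΨ hP fun j _ => hF j
  have hQ0 : 0 ≤ quantumError Ψ P := Finset.sum_nonneg fun j _ =>
    mul_nonneg (outcomeProb_nonneg _ _) (traceNorm_nonneg _)
  refine ⟨U, hU, fun j _ => hF j, isOneWayLOCC_measureAndDecode hP hU,
    ⟨one_pos, hL, isLOCC_measureAndDecode hP hU, ?_⟩, by simp [entanglementCost], ?_⟩
  · have h0 : 0 ≤ fidelity (mergingOutput Ψ (measureAndDecode P U)) (proj (mergingTarget Ψ L)) :=
      sq_nonneg _
    have hs := Real.sq_sqrt (hQ0.trans hQ)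
    have hs0 := Real.sqrt_nonneg ε
    rw [mergingOutput_measureAndDecode, fidelity_sum_proj] at h0 ⊢
    -- For √ε ≤ 2 one has ε = (√ε)² ≤ 2√ε; otherwise 1 - 2√ε is negative and the bound is trivial.
    rcases le_total (√ε) 2 with h | h
    · nlinarith
    · linarith
  · rw [mergingOutput_measureAndDecode]
    refine (traceNorm_sum_proj_sub_proj_le _ _ (isStateVector_mergingTarget hΨ hL) ?_).trans ?_
    · simp only [sum_norm_sq_kronecker_mulVec Ψ _ (hU _), sum_outcomeProb hΨ hP]
    · gcongr
      linarith
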